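/- For $0<v<1$ and real $\kappa,\delta$ with $-\tfrac12<\kappa<\tfrac12$, $0\le\delta<\tfrac12$, put $$f_1(\kappa,\delta;v)=v^{\kappa/2}(1-v)^{-\kappa/2}\,{}_2F_1\!\left(\delta,-\delta;\tfrac12+\kappa;v\right),$$ $$f_2(\kappa,\delta;v)=\frac{\delta}{\frac12+\kappa}\,v^{(\kappa+1)/2}(1-v)^{(1-\kappa)/2}\,{}_2F_1\!\left(1+\delta,1-\delta;\tfrac32+\kappa;v\right),$$ $$H(\kappa,\delta)=\frac{\Gamma(\frac12+\kappa)^2}{\Gamma(\frac12+\kappa+\delta)\,\Gamma(\frac12+\kappa-\delta)}$$ (with $1/\Gamma(0)=0$), where ${}_2F_1(a,b;c;v)=\sum_{n\ge0}\frac{(a)_n(b)_n}{(c)_n\,n!}v^n$ is the Gauss hypergeometric series, and $$G_1(\kappa,\delta;v)=\bigl(f_1(\kappa,\delta;v)^2+f_2(\kappa,\delta;v)^2\bigr)H(-\kappa,\delta)+\bigl(f_1(-\kappa,\delta;v)^2+f_2(-\kappa,\delta;v)^2\bigr)H(\kappa,\delta).$$ **Proposition 6.3 (separation of $\kappa$).**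 Suppose $-\frac12<\kappa<\frac12$ and $0\le\delta<\frac12$. Then the functions $v\mapsto G_1(\kappa,\delta;v)(v(1-v))^{-1/2}$ and $v\mapsto G_1(0,\delta;v)(v(1-v))^{-1/2}$ are integrable on $(0,1)$, and $$\int_0^1 G_1(\kappa,\delta;v)\,(v(1-v))^{-1/2}\,dv=\frac{1}{\cos\pi\kappa}\int_0^1 G_1(0,\delta;v)\,(v(1-v))^{-1/2}\,dv .$$ -/

import Mathlib

open MeasureTheory

noncomputable section

namespace DihedralKernel

/-- `f₁(κ,δ;v) = v^{κ/2} (1-v)^{-κ/2} ₂F₁(δ,-δ; 1/2+κ; v)`, used for `0 < v < 1`. -/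
def f₁ (κ δ v : ℝ) : ℝ :=
  v ^ (κ / 2) * (1 - v) ^ (-κ / 2) * ordinaryHypergeometric δ (-δ) (1 / 2 + κ) v

/-- `f₂(κ,δ;v) = δ/(1/2+κ) v^{(κ+1)/2} (1-v)^{(1-κ)/2} ₂F₁(1+δ,1-δ; 3/2+κ; v)`,
used for `0 < v < 1`. -/
def f₂ (κ δ v : ℝ) : ℝ :=
  δ / (1 / 2 + κ) * (v ^ ((κ + 1) / 2) * (1 - v) ^ ((1 - κ) / 2)) *
    ordinaryHypergeometric (1 + δ) (1 - δ) (3 / 2 + κ) v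

/-- `H(κ,δ) = Γ(1/2+κ)² / (Γ(1/2+κ+δ) Γ(1/2+κ-δ))`.  At a pole of a Gamma factor of the
denominator, Mathlib's conventions `Γ = 0` and `x / 0 = 0` give `H = 0`, which is the usual
convention `1/Γ = 0` there. -/
def H (κ δ : ℝ) : ℝ :=
  Real.Gamma (1 / 2 + κ) ^ 2 /
    (Real.Gamma (1 / 2 + κ + δ) * Real.Gamma (1 / 2 + κ - δ))

/-- `G₁(κ,δ;v)`, the diagonal entry (up to normalization) of the weight matrix in complex
coordinates. -/
def G₁ (κ δ v : ℝ) : ℝ :=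
  (f₁ κ δ v ^ 2 + f₂ κ δ v ^ 2) * H (-κ) δ + (f₁ (-κ) δ v ^ 2 + f₂ (-κ) δ v ^ 2) * H κ δ

end DihedralKernel

end

noncomputable section

namespace DihedralKernel

open Filter Topology Finset


/-! Put c = 1/2 + κ, F = `hypF c δ`, S = `hypS c δ`, w = `fWeight c`, p = `sWeight c`. Multiplied by
(v(1-v))^(-1/2), f₁² + f₂² becomes wF² + pS², and F, S solve the Sturm-Liouville system F' = -δS,
(pS)' = δwF. For two parameters δ, ε the Wronskian F_ε pS_δ - F_δ pS_ε therefore has derivative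
(δ-ε)(wF_δF_ε + pS_δS_ε), so the integral of the pairing is given by boundary values
(`integral_pairing`). At 0 they vanish; at 1, pS tends to sin πδ / sin πc (`tendsto_rpow_mul_hypS`),
and F(1) is given by Gauss's theorem (`hypF_one_eq_Gamma`), which also shows H(κ,δ) = F(1).

Letting ε → δ gives (Aπ cos πδ - A' sin πδ) / sin πc for the squared norm, where A = F(1) and A' =
∂A/∂δ (`integral_pairing_self`). Replacing κ by -κ replaces c by 1-c and A by B, say. In the
combination weighted by B and A, the derivatives occur only as (AB)', and the reflection formula
gives AB = 1 - sin² πδ / sin² πc (`hypF_one_mul_hypF_one`). Everything collapses to 2π cos πδ / sin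
πc, and sin πc = cos πκ. -/

/-- Coefficients of `₂F₁(1+δ,1-δ;1+c;v)`. -/
def kCoeff (c δ : ℝ) (n : ℕ) : ℝ :=
  ∏ j ∈ range n, (((j : ℝ) + 1) ^ 2 - δ ^ 2) / ((c + 1 + j) * (j + 1))

/-- Coefficients of `(δ/c) ₂F₁(1+δ,1-δ;1+c;v)`. -/
def sCoeff (c δ : ℝ) (n : ℕ) : ℝ := δ / c * kCoeff c δ n

/-- Coefficients of `₂F₁(δ,-δ;c;v)`. -/
def fCoeff (c δ : ℝ) : ℕ → ℝ
  | 0 => 1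
  | n + 1 => -(δ * sCoeff c δ n) / (n + 1)

/-- The series `₂F₁(δ,-δ;c;v)`. -/
def hypF (c δ v : ℝ) : ℝ := ∑' n, fCoeff c δ n * v ^ n

/-- The series `(δ/c) ₂F₁(1+δ,1-δ;1+c;v)`. -/
def hypS (c δ v : ℝ) : ℝ := ∑' n, sCoeff c δ n * v ^ n

lemma kCoeff_zero (c δ : ℝ) : kCoeff c δ 0 = 1 := by simp [kCoeff]

lemma kCoeff_succ (c δ : ℝ) (n : ℕ) : kCoeff c δ (n + 1) =
    kCoeff c δ n * ((((n : ℝ) + 1) ^ 2 - δ ^ 2) / ((c + 1 + n) * (n + 1))) :=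
  prod_range_succ _ _

lemma kCoeff_eq (c δ : ℝ) (n : ℕ) :
    ((n.factorial : ℝ)⁻¹ * (ascPochhammer ℝ n).eval (1 + δ) * (ascPochhammer ℝ n).eval (1 - δ) *
      ((ascPochhammer ℝ n).eval (1 + c))⁻¹) = kCoeff c δ n := by
  induction n with
  | zero => simp [kCoeff]
  | succ n ih =>
    rw [kCoeff_succ, ← ih]
    simp only [ascPochhammer_succ_eval, Nat.factorial_succ, Nat.cast_mul, Nat.cast_succ, mul_inv,
      div_eq_mul_inv, add_comm c 1]
    ring

lemma fCoeff_eq (c δ : ℝ) (n : ℕ) :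
    ((n.factorial : ℝ)⁻¹ * (ascPochhammer ℝ n).eval δ * (ascPochhammer ℝ n).eval (-δ) *
      ((ascPochhammer ℝ n).eval c)⁻¹) = fCoeff c δ n := by
  cases n with
  | zero => simp [fCoeff]
  | succ n =>
    have h (x : ℝ) : (ascPochhammer ℝ (n + 1)).eval x = x * (ascPochhammer ℝ n).eval (1 + x) := by
      simp [ascPochhammer_succ_left, Polynomial.eval_comp, add_comm]
    simp only [fCoeff, sCoeff, ← kCoeff_eq, h, Nat.factorial_succ, Nat.cast_mul, Nat.cast_succ,
      mul_inv, div_eq_mul_inv, ← sub_eq_add_neg]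
    ring

lemma hypF_eq (c δ v : ℝ) : ordinaryHypergeometric δ (-δ) c v = hypF c δ v := by
  rw [ordinaryHypergeometric_eq_tsum]
  simp only [fCoeff_eq, hypF, smul_eq_mul]

lemma hypS_eq (c δ v : ℝ) :
    δ / c * ordinaryHypergeometric (1 + δ) (1 - δ) (1 + c) v = hypS c δ v := by
  rw [ordinaryHypergeometric_eq_tsum]
  simp only [kCoeff_eq, hypS, sCoeff, smul_eq_mul]
  rw [← tsum_mul_left]
  exact tsum_congr fun n => by ring

/-! ### Power series with bounded coefficients -/

section PowerSeries

variable {a : ℕ → ℝ} {M x : ℝ}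

lemma summable_mul_pow (ha : ∀ n, |a n| ≤ M) (hx : |x| < 1) :
    Summable fun n => a n * x ^ n := by
  refine Summable.of_norm_bounded
    ((summable_geometric_of_lt_one (abs_nonneg x) hx).mul_left M) fun n => ?_
  rw [Real.norm_eq_abs, abs_mul, abs_pow]
  exact mul_le_mul_of_nonneg_right (ha n) (by positivity)

lemma summable_natCast_mul_pow {r : ℝ} (hr : |r| < 1) :
    Summable fun n : ℕ => (n : ℝ) * r ^ n := by
  simpa using summable_pow_mul_geometric_of_norm_lt_one 1 (r := r) (by simpa using hr)

lemma summable_natCast_mul_mul_pow (ha : ∀ n, |a n| ≤ M) (hx : |x| < 1) :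
    Summable fun n : ℕ => n * a n * x ^ n := by
  refine Summable.of_norm_bounded
    ((summable_natCast_mul_pow (r := |x|) (by simpa using hx)).mul_left M) fun n => ?_
  rw [Real.norm_eq_abs, abs_mul, abs_mul, abs_pow, Nat.abs_cast]
  have := mul_le_mul_of_nonneg_right (ha n) (by positivity : 0 ≤ (n : ℝ) * |x| ^ n)
  linarith

lemma hasDerivAt_tsum_mul_pow (ha : ∀ n, |a n| ≤ M) (hx : |x| < 1) :
    HasDerivAt (fun z => ∑' n, a n * z ^ n) (∑' n : ℕ, (n + 1) * a (n + 1) * x ^ n) x := by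
  obtain ⟨r, hxr, hr1⟩ := exists_between hx
  have hr0 : 0 < r := (abs_nonneg x).trans_lt hxr
  have hu : Summable fun n : ℕ => M * (n * r ^ (n - 1)) := by
    rw [← summable_nat_add_iff 1]
    refine Summable.mul_left M ?_
    have hra : |r| < 1 := by rwa [abs_of_pos hr0]
    refine ((summable_natCast_mul_pow hra).add (summable_geometric_of_abs_lt_one hra)).congr
      fun n => ?_
    simp
    ring
  have hb : ∀ (n : ℕ) (y : ℝ), y ∈ Metric.ball (0 : ℝ) r →
      ‖a n * (n * y ^ (n - 1))‖ ≤ M * (n * r ^ (n - 1)) := by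
    intro n y hy
    have hy' : |y| ≤ r := by simpa using (Metric.mem_ball.1 hy).le
    rw [Real.norm_eq_abs, abs_mul, abs_mul, abs_pow, Nat.abs_cast]
    have hM : 0 ≤ M := (abs_nonneg _).trans (ha 0)
    gcongr
    exact ha n
  have key := hasDerivAt_tsum_of_isPreconnected hu Metric.isOpen_ball
    (convex_ball (0 : ℝ) r).isPreconnected
    (g := fun n z => a n * z ^ n) (g' := fun n z => a n * (n * z ^ (n - 1)))
    (fun n y _ => by simpa using (hasDerivAt_pow n y).const_mul (a n)) hb
    (y₀ := x) (by simpa using hxr) (summable_mul_pow ha hx) (y := x) (by simpa using hxr)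
  refine key.congr_deriv ?_
  rw [(Summable.of_norm_bounded hu fun n => hb n x (by simpa using hxr)).tsum_eq_zero_add]
  simp only [Nat.cast_zero, zero_mul, mul_zero, zero_add, Nat.cast_succ, Nat.add_sub_cancel]
  exact tsum_congr fun n => by ring

end PowerSeries

/-! ### Coefficient bounds uniform in δ, and continuity -/

section Bounds

variable {c δ : ℝ}

lemma kCoeff_nonneg (hc : 0 < c) (hδ : |δ| < 1) (n : ℕ) : 0 ≤ kCoeff c δ n := by
  refine prod_nonneg fun j _ => div_nonneg ?_ (by positivity)
  have := (sq_lt_one_iff_abs_lt_one δ).2 hδ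
  nlinarith [(Nat.cast_nonneg j : (0 : ℝ) ≤ j)]

lemma kCoeff_le_kCoeff_zero (hc : 0 < c) (hδ : |δ| < 1) (n : ℕ) :
    kCoeff c δ n ≤ kCoeff c 0 n := by
  refine prod_le_prod (fun j _ => div_nonneg ?_ (by positivity)) fun j _ => ?_
  · have := (sq_lt_one_iff_abs_lt_one δ).2 hδ
    nlinarith [(Nat.cast_nonneg j : (0 : ℝ) ≤ j)]
  · exact div_le_div_of_nonneg_right (by nlinarith [sq_nonneg δ]) (by positivity)

lemma kCoeff_zero_le_one (hc : 0 < c) (n : ℕ) : kCoeff c 0 n ≤ 1 := by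
  refine prod_le_one (fun j _ => div_nonneg (by nlinarith) (by positivity)) fun j _ => ?_
  rw [div_le_one (by positivity)]
  nlinarith [(Nat.cast_nonneg j : (0 : ℝ) ≤ j)]

lemma kCoeff_zero_anti {c' : ℝ} (hc : 0 < c) (h : c ≤ c') (n : ℕ) :
    kCoeff c' 0 n ≤ kCoeff c 0 n := by
  refine prod_le_prod (fun j _ => div_nonneg (by nlinarith) ?_) fun j _ => ?_
  · have := hc.trans_le h
    positivity
  · have : 0 ≤ ((j : ℝ) + 1) ^ 2 - 0 ^ 2 := by nlinarith
    gcongr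

lemma abs_sCoeff_le (hc : 0 < c) (hδ : |δ| < 1) (n : ℕ) :
    |sCoeff c δ n| ≤ 1 / c * kCoeff c 0 n := by
  rw [sCoeff, abs_mul, abs_div, abs_of_pos hc, abs_of_nonneg (kCoeff_nonneg hc hδ n)]
  have := kCoeff_le_kCoeff_zero hc hδ n
  have := kCoeff_nonneg hc hδ n
  gcongr

lemma abs_sCoeff_le' (hc : 0 < c) (hδ : |δ| < 1) (n : ℕ) : |sCoeff c δ n| ≤ 1 / c :=
  (abs_sCoeff_le hc hδ n).trans
    (mul_le_of_le_one_right (by positivity) (kCoeff_zero_le_one hc n))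

/-- A summable majorant of `fCoeff`, uniform in `δ`. -/
def fBound (c : ℝ) : ℕ → ℝ
  | 0 => 1
  | n + 1 => 1 / c * kCoeff c 0 n / (n + 1)

lemma abs_fCoeff_le (hc : 0 < c) (hδ : |δ| < 1) (n : ℕ) : |fCoeff c δ n| ≤ fBound c n := by
  cases n with
  | zero => simp [fCoeff, fBound]
  | succ n =>
    have h0 : |((n : ℝ) + 1)| = n + 1 := abs_of_pos (by positivity)
    rw [fCoeff, fBound, abs_div, abs_neg, abs_mul, h0]
    refine div_le_div_of_nonneg_right ?_ (by positivity)
    calc |δ| * |sCoeff c δ n| ≤ 1 * |sCoeff c δ n| := by gcongr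
      _ ≤ _ := by rw [one_mul]; exact abs_sCoeff_le hc hδ n

lemma kCoeff_zero_sub_succ (hc : 0 < c) (n : ℕ) :
    kCoeff c 0 n - kCoeff c 0 (n + 1) = c * (kCoeff c 0 n / (c + 1 + n)) := by
  rw [kCoeff_succ]
  have : c + 1 + n ≠ 0 := by positivity
  have : (n : ℝ) + 1 ≠ 0 := by positivity
  field_simp
  ring

/-- The terms `kCoeff c 0 n / (c + 1 + n)` are, up to the factor c, consecutive differences of the
nonnegative sequence `kCoeff c 0`, so their sums telescope; `fBound` is comparable to them. This
gives control of F up to v = 1. -/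
lemma summable_fBound (hc : 0 < c) : Summable (fBound c) := by
  rw [← summable_nat_add_iff 1]
  have hk (n : ℕ) : 0 ≤ kCoeff c 0 n := kCoeff_nonneg hc (by simp) n
  have h1 : Summable fun n : ℕ => c * (kCoeff c 0 n / (c + 1 + n)) := by
    refine summable_of_sum_range_le (c := 1) (fun n => ?_) fun n => ?_
    · have := hk n
      positivity
    · simp only [← kCoeff_zero_sub_succ hc]
      rw [sum_range_sub']
      have := hk n
      rw [kCoeff_zero]
      linarith
  refine Summable.of_nonneg_of_le (fun n => ?_) (fun n => ?_) (h1.mul_left ((c + 1) / c ^ 2))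
  · have := hk n
    simp only [fBound]
    positivity
  · have h2 : kCoeff c 0 n / (n + 1) ≤ (c + 1) * (kCoeff c 0 n / (c + 1 + n)) := by
      rw [← mul_div_assoc, div_le_div_iff₀ (by positivity) (by positivity)]
      nlinarith [mul_nonneg (hk n) (mul_nonneg hc.le (Nat.cast_nonneg n : (0 : ℝ) ≤ n))]
    calc fBound c (n + 1) = 1 / c * (kCoeff c 0 n / (n + 1)) := by simp only [fBound]; ring
      _ ≤ 1 / c * ((c + 1) * (kCoeff c 0 n / (c + 1 + n))) := by gcongr
      _ = _ := by field_simp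

lemma fBound_nonneg (hc : 0 < c) (n : ℕ) : 0 ≤ fBound c n :=
  (abs_nonneg _).trans (abs_fCoeff_le hc (δ := 0) (by simp) n)

lemma abs_fCoeff_le_tsum (hc : 0 < c) (hδ : |δ| < 1) (n : ℕ) :
    |fCoeff c δ n| ≤ ∑' n, fBound c n :=
  (abs_fCoeff_le hc hδ n).trans
    ((summable_fBound hc).le_tsum n fun m _ => fBound_nonneg hc m)

lemma norm_fCoeff_mul_pow_le (hc : 0 < c) (hδ : |δ| < 1) {v : ℝ} (hv : v ∈ Set.Icc (0 : ℝ) 1)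
    (n : ℕ) : ‖fCoeff c δ n * v ^ n‖ ≤ fBound c n := by
  rw [norm_mul, norm_pow, Real.norm_eq_abs, Real.norm_eq_abs, abs_of_nonneg hv.1]
  exact (mul_le_of_le_one_right (abs_nonneg _) (pow_le_one₀ hv.1 hv.2)).trans
    (abs_fCoeff_le hc hδ n)

lemma abs_hypF_le (hc : 0 < c) (hδ : |δ| < 1) {v : ℝ} (hv : v ∈ Set.Icc (0 : ℝ) 1) :
    |hypF c δ v| ≤ ∑' n, fBound c n :=
  tsum_of_norm_bounded (summable_fBound hc).hasSum (norm_fCoeff_mul_pow_le hc hδ hv)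

lemma continuousOn_hypF (hc : 0 < c) (hδ : |δ| < 1) :
    ContinuousOn (hypF c δ) (Set.Icc 0 1) :=
  continuousOn_tsum (fun n => by fun_prop) (summable_fBound hc)
    fun n _ hv => norm_fCoeff_mul_pow_le hc hδ hv n

lemma continuous_sCoeff (c : ℝ) (n : ℕ) : Continuous fun δ => sCoeff c δ n := by
  simp only [sCoeff, kCoeff, div_eq_mul_inv]
  fun_prop

lemma continuous_fCoeff (c : ℝ) (n : ℕ) : Continuous fun δ => fCoeff c δ n := by
  cases n with
  | zero => exact continuous_const
  | succ n =>
    have := continuous_sCoeff c n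
    simp only [fCoeff, div_eq_mul_inv]
    fun_prop

lemma isOpen_abs_lt_one : IsOpen {δ : ℝ | |δ| < 1} := isOpen_lt continuous_abs continuous_const

lemma continuousAt_hypF (hc : 0 < c) (hδ : |δ| < 1) {v : ℝ} (hv : v ∈ Set.Icc (0 : ℝ) 1) :
    ContinuousAt (fun ε => hypF c ε v) δ := by
  refine ContinuousOn.continuousAt (s := {δ : ℝ | |δ| < 1}) ?_ (isOpen_abs_lt_one.mem_nhds hδ)
  exact continuousOn_tsum (fun n => ((continuous_fCoeff c n).mul continuous_const).continuousOn)
    (summable_fBound hc) fun n ε hε => norm_fCoeff_mul_pow_le hc hε hv n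

lemma continuousAt_hypS (hc : 0 < c) (hδ : |δ| < 1) {v : ℝ} (hv : |v| < 1) :
    ContinuousAt (fun ε => hypS c ε v) δ := by
  refine ContinuousOn.continuousAt (s := {δ : ℝ | |δ| < 1}) ?_ (isOpen_abs_lt_one.mem_nhds hδ)
  refine continuousOn_tsum
    (fun n => ((continuous_sCoeff c n).mul continuous_const).continuousOn)
    ((summable_geometric_of_lt_one (abs_nonneg v) hv).mul_left (1 / c)) fun n ε hε => ?_
  rw [norm_mul, norm_pow, Real.norm_eq_abs, Real.norm_eq_abs]
  exact mul_le_mul_of_nonneg_right (abs_sCoeff_le' hc hε n) (by positivity)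

end Bounds

/-! ### The first-order differential system -/

section System

variable {c δ v : ℝ}

lemma hasDerivAt_hypF (hc : 0 < c) (hδ : |δ| < 1) (hv : |v| < 1) :
    HasDerivAt (hypF c δ) (-δ * hypS c δ v) v := by
  refine (hasDerivAt_tsum_mul_pow (abs_fCoeff_le_tsum hc hδ) hv).congr_deriv ?_
  rw [hypS, ← tsum_mul_left]
  refine tsum_congr fun n => ?_
  rw [fCoeff]
  field_simp

lemma hasDerivAt_hypS (hc : 0 < c) (hδ : |δ| < 1) (hv : |v| < 1) :
    ∃ D, HasDerivAt (hypS c δ) D v ∧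
      v * (1 - v) * D + (c - v) * hypS c δ v = δ * hypF c δ v := by
  have hb := abs_sCoeff_le' hc hδ
  refine ⟨_, hasDerivAt_tsum_mul_pow hb hv, ?_⟩
  have hs := summable_mul_pow hb hv
  have hns := summable_natCast_mul_mul_pow hb hv
  have hf := summable_mul_pow (abs_fCoeff_le_tsum hc hδ) hv
  have e1 : ∑' n : ℕ, n * sCoeff c δ n * v ^ n =
      v * ∑' n : ℕ, (n + 1) * sCoeff c δ (n + 1) * v ^ n := by
    rw [hns.tsum_eq_zero_add, ← tsum_mul_left]
    simp only [Nat.cast_zero, zero_mul, zero_add, Nat.cast_succ]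
    exact tsum_congr fun n => by ring
  -- With θ = v d/dv this is θS + cS - δF = v(θS + S). The constant term on the left vanishes, and
  -- the others match by the recurrence of `kCoeff`.
  have e2 : (∑' n : ℕ, n * sCoeff c δ n * v ^ n) + c * hypS c δ v - δ * hypF c δ v =
      v * ((∑' n : ℕ, n * sCoeff c δ n * v ^ n) + hypS c δ v) := by
    have h := ((hns.hasSum.add (hs.hasSum.mul_left c)).sub (hf.hasSum.mul_left δ))
    rw [hypS, hypF, ← h.tsum_eq, h.summable.tsum_eq_zero_add, ← hns.tsum_add hs, ← tsum_mul_left]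
    have h0 : ((0 : ℕ) : ℝ) * sCoeff c δ 0 * v ^ 0 + c * (sCoeff c δ 0 * v ^ 0) -
        δ * (fCoeff c δ 0 * v ^ 0) = 0 := by
      simp only [sCoeff, fCoeff, kCoeff_zero]
      field_simp
      simp
    rw [h0, zero_add]
    refine tsum_congr fun n => ?_
    simp only [sCoeff, fCoeff, kCoeff_succ, Nat.cast_succ]
    have : c + 1 + n ≠ 0 := by positivity
    field_simp
    ring
  rw [e1] at e2
  linear_combination e2

end System


/-! ### Gauss's summation theorem -/

section Gauss

variable {c δ : ℝ}

lemma kCoeff_add_one (hc : 0 < c) (δ : ℝ) (n : ℕ) :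
    kCoeff (c + 1) δ n = (c + 1) / (c + 1 + n) * kCoeff c δ n := by
  induction n with
  | zero =>
    have : c + 1 ≠ 0 := by positivity
    simp [kCoeff_zero, this]
  | succ n ih =>
    rw [kCoeff_succ, kCoeff_succ, ih]
    push_cast
    have : c + 1 + n ≠ 0 := by positivity
    have : c + 1 + 1 + n ≠ 0 := by positivity
    have : c + 1 + (n + 1) ≠ 0 := by positivity
    field_simp
    ring

/-- For n > 0 the coefficient equals c · `GammaSeq c n` · n^(-c), and `GammaSeq c n` converges. -/
lemma tendsto_kCoeff_zero (hc : 0 < c) : Tendsto (kCoeff c 0) atTop (𝓝 0) := by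
  have h := ((Real.GammaSeq_tendsto_Gamma c).const_mul c).mul
    ((tendsto_rpow_neg_atTop hc).comp tendsto_natCast_atTop_atTop)
  rw [mul_zero] at h
  refine h.congr' ?_
  filter_upwards [eventually_gt_atTop 0] with n hn
  have hn' : (0 : ℝ) < n := by exact_mod_cast hn
  have hk : kCoeff c 0 n = n.factorial / ∏ j ∈ range n, (c + 1 + j) := by
    rw [kCoeff, ← prod_range_add_one_eq_factorial, Nat.cast_prod, ← prod_div_distrib]
    refine prod_congr rfl fun j _ => ?_
    have : c + 1 + j ≠ 0 := by positivity
    push_cast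
    field_simp
    ring
  have hp : ∏ j ∈ range n, (c + 1 + j) ≠ 0 := prod_ne_zero_iff.2 fun j _ => by positivity
  rw [hk, Real.GammaSeq, prod_range_succ', Function.comp_apply, Real.rpow_neg hn'.le]
  have hr : ((n : ℝ) ^ c) ≠ 0 := by positivity
  have e : ∏ j ∈ range n, (c + ((j + 1 : ℕ) : ℝ)) = ∏ j ∈ range n, (c + 1 + j) :=
    prod_congr rfl fun j _ => by push_cast; ring
  rw [e]
  simp only [Nat.cast_zero, add_zero]
  field_simp

lemma summable_fCoeff (hc : 0 < c) (hδ : |δ| < 1) : Summable (fCoeff c δ) :=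
  Summable.of_norm_bounded (summable_fBound hc) (abs_fCoeff_le hc hδ)

lemma hypF_one (c δ : ℝ) : hypF c δ 1 = ∑' n, fCoeff c δ n := by simp [hypF]

/-- The bracket telescopes, so summing over n turns this into the contiguous relation between c and
c + 1 at v = 1. -/
lemma fCoeff_contiguous (hc : 0 < c) (δ : ℝ) (n : ℕ) :
    ((n + 1 : ℕ) * fCoeff c δ (n + 1) - n * fCoeff c δ n) + c * fCoeff c δ n =
      (c ^ 2 - δ ^ 2) / c * fCoeff (c + 1) δ n := by
  cases n with
  | zero =>
    simp only [fCoeff, sCoeff, kCoeff_zero]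
    field_simp
    push_cast
    ring
  | succ n =>
    simp only [fCoeff, sCoeff, kCoeff_succ, kCoeff_add_one hc]
    have : c + 1 + n ≠ 0 := by positivity
    have : (n : ℝ) + 1 + 1 ≠ 0 := by positivity
    push_cast
    field_simp
    ring

lemma hypF_one_contiguous (hc : 0 < c) (hδ : |δ| < 1) :
    hypF c δ 1 = (c ^ 2 - δ ^ 2) / c ^ 2 * hypF (c + 1) δ 1 := by
  have hc1 : 0 < c + 1 := by positivity
  have h1 := (summable_fCoeff hc hδ).hasSum.mul_left c
  have h2 := (summable_fCoeff hc1 hδ).hasSum.mul_left ((c ^ 2 - δ ^ 2) / c)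
  have h3 : Tendsto (fun N : ℕ => (N : ℝ) * fCoeff c δ N) atTop (𝓝 0) := by
    rw [← tendsto_add_atTop_iff_nat 1]
    have hs : Tendsto (sCoeff c δ) atTop (𝓝 0) := by
      have := (tendsto_kCoeff_zero hc).const_mul (1 / c)
      rw [mul_zero] at this
      exact squeeze_zero_norm (abs_sCoeff_le hc hδ) this
    have := hs.const_mul (-δ)
    rw [mul_zero] at this
    refine this.congr fun n => ?_
    rw [fCoeff]
    push_cast
    field_simp
  have h4 := h3.add h1.tendsto_sum_nat
  have h5 : hypF c δ 1 * c = (c ^ 2 - δ ^ 2) / c * hypF (c + 1) δ 1 := by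
    rw [hypF_one, hypF_one]
    have := tendsto_nhds_unique (h4.congr fun N => ?_) h2.tendsto_sum_nat
    · linarith
    · rw [← sum_congr rfl fun n _ => fCoeff_contiguous hc δ n, sum_add_distrib,
        sum_range_sub fun n : ℕ => (n : ℝ) * fCoeff c δ n]
      simp
  rw [← mul_right_cancel_iff_of_pos hc, h5]
  field_simp

lemma hypF_one_eq_prod (hc : 0 < c) (hδ : |δ| < 1) (n : ℕ) :
    hypF c δ 1 = (∏ j ∈ range n, ((c + j) ^ 2 - δ ^ 2) / (c + j) ^ 2) * hypF (c + n) δ 1 := by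
  induction n with
  | zero => simp
  | succ n ih =>
    rw [ih, hypF_one_contiguous (by positivity : 0 < c + n) hδ, prod_range_succ]
    push_cast
    rw [add_assoc, mul_assoc]

/-- Every coefficient but the zeroth tends to 0 as c + n grows, and `fBound c` dominates them all
because the bounds decrease in c. -/
lemma tendsto_hypF_one (hc : 0 < c) (hδ : |δ| < 1) :
    Tendsto (fun n : ℕ => hypF (c + n) δ 1) atTop (𝓝 1) := by
  simp only [hypF_one]
  have hs : ∑' m : ℕ, (if m = 0 then (1 : ℝ) else 0) = 1 := tsum_ite_eq 0 fun _ => 1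
  rw [← hs]
  have hle (n : ℕ) : c ≤ c + n := by linarith [(Nat.cast_nonneg n : (0 : ℝ) ≤ n)]
  refine tendsto_tsum_of_dominated_convergence (summable_fBound hc) (fun m => ?_)
    (Eventually.of_forall fun n m => ?_)
  · cases m with
    | zero => simp [fCoeff]
    | succ m =>
      have hlim : Tendsto (fun n : ℕ => 1 / (c + (n : ℝ))) atTop (𝓝 0) :=
        tendsto_const_nhds.div_atTop
          (tendsto_atTop_add_const_left _ _ tendsto_natCast_atTop_atTop)
      refine squeeze_zero_norm (fun n => ?_) hlim
      have hcn : 0 < c + n := by positivity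
      refine (abs_fCoeff_le hcn hδ (m + 1)).trans ?_
      rw [fBound, mul_div_assoc]
      refine mul_le_of_le_one_right (by positivity) ?_
      rw [div_le_one (by positivity)]
      linarith [kCoeff_zero_le_one hcn m, (Nat.cast_nonneg m : (0 : ℝ) ≤ m)]
  · refine (abs_fCoeff_le (hc.trans_le (hle n)) hδ m).trans ?_
    cases m with
    | zero => simp [fBound]
    | succ m =>
      have h1 := kCoeff_zero_anti hc (hle n) m
      have h2 : 0 ≤ kCoeff (c + n) 0 m := kCoeff_nonneg (hc.trans_le (hle n)) (by simp) m
      have := hle n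
      simp only [fBound]
      gcongr

lemma GammaSeq_quotient {n : ℕ} (hn : 0 < n) :
    Real.GammaSeq c n ^ 2 / (Real.GammaSeq (c + δ) n * Real.GammaSeq (c - δ) n) =
      ∏ j ∈ range (n + 1), ((c + j) ^ 2 - δ ^ 2) / (c + j) ^ 2 := by
  have hn' : (0 : ℝ) < n := by exact_mod_cast hn
  have e1 : (n : ℝ) ^ (c + δ) * (n : ℝ) ^ (c - δ) = ((n : ℝ) ^ c) ^ 2 := by
    rw [← Real.rpow_add hn', ← Real.rpow_natCast, ← Real.rpow_mul hn'.le]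
    push_cast
    ring_nf
  have hr : ((n : ℝ) ^ c) ≠ 0 := by positivity
  have hf : (n.factorial : ℝ) ≠ 0 := by positivity
  have e2 : (∏ j ∈ range (n + 1), ((c + j) ^ 2 - δ ^ 2)) =
      (∏ j ∈ range (n + 1), (c + δ + j)) * ∏ j ∈ range (n + 1), (c - δ + j) := by
    rw [← prod_mul_distrib]
    exact prod_congr rfl fun j _ => by ring
  rw [prod_div_distrib, e2, prod_pow]
  simp only [Real.GammaSeq]
  have e3 : (n : ℝ) ^ (c + δ) * n.factorial * ((n : ℝ) ^ (c - δ) * n.factorial) =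
      ((n : ℝ) ^ c * n.factorial) ^ 2 := by linear_combination (n.factorial : ℝ) ^ 2 * e1
  rw [div_mul_div_comm, e3, div_pow, div_div_div_cancel_left' _ _ (by positivity)]

/-- **Gauss's summation theorem** for `₂F₁(δ,-δ;c;1)`. -/
theorem hypF_one_eq_Gamma (hc : 0 < c) (hδ : |δ| < 1) :
    hypF c δ 1 = Real.Gamma c ^ 2 / (Real.Gamma (c + δ) * Real.Gamma (c - δ)) := by
  -- Since c ± δ > -1, a zero value of Γ (a pole) forces c + δ = 0 or c - δ = 0. Then the contiguous
  -- relation gives F(1) = 0, matching division by zero on the right.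
  by_cases h0 : Real.Gamma (c + δ) * Real.Gamma (c - δ) = 0
  · have hz : c ^ 2 - δ ^ 2 = 0 := by
      by_contra hne
      have h1 : ∀ s : ℝ, -1 < s → s ≠ 0 → Real.Gamma s ≠ 0 := by
        intro s hs hs0
        refine Real.Gamma_ne_zero fun m hm => ?_
        rcases m with _ | m
        · simp at hm
          exact hs0 hm
        · push_cast at hm
          linarith [(Nat.cast_nonneg m : (0 : ℝ) ≤ m)]
      have h2 := abs_lt.1 hδ
      refine mul_ne_zero (h1 _ (by linarith) fun h => hne ?_) (h1 _ (by linarith) fun h => hne ?_) h0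
      · linear_combination (c - δ) * h
      · linear_combination (c + δ) * h
    rw [hypF_one_contiguous hc hδ, hz, h0]
    simp
  · have h1 : Tendsto (fun n : ℕ => ∏ j ∈ range (n + 1), ((c + j) ^ 2 - δ ^ 2) / (c + j) ^ 2) atTop
        (𝓝 (Real.Gamma c ^ 2 / (Real.Gamma (c + δ) * Real.Gamma (c - δ)))) := by
      refine ((((Real.GammaSeq_tendsto_Gamma c).pow 2).div
        ((Real.GammaSeq_tendsto_Gamma (c + δ)).mul (Real.GammaSeq_tendsto_Gamma (c - δ)))
        h0)).congr' ?_
      filter_upwards [eventually_gt_atTop 0] with n hn using GammaSeq_quotient hn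
    have h2 := h1.mul ((tendsto_add_atTop_iff_nat 1).2 (tendsto_hypF_one hc hδ))
    rw [mul_one] at h2
    refine tendsto_nhds_unique (h2.congr fun n => ?_) tendsto_const_nhds |>.symm
    exact (hypF_one_eq_prod hc hδ (n + 1)).symm

end Gauss

/-! ### Behaviour of S at v = 1 -/

section Abel

/-- The coefficients of `(1-x)^(c-1)`. -/
def binCoeff (c : ℝ) (n : ℕ) : ℝ := ∏ j ∈ range n, ((j : ℝ) + 1 - c) / (j + 1)

variable {c δ x : ℝ}

lemma binCoeff_pos (hc : c < 1) (n : ℕ) : 0 < binCoeff c n :=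
  prod_pos fun j _ => div_pos (by linarith [(Nat.cast_nonneg j : (0 : ℝ) ≤ j)]) (by positivity)

lemma binCoeff_eq_choose (c : ℝ) (n : ℕ) : Ring.choose (1 - c + n - 1) n = binCoeff c n := by
  rw [← Ring.multichoose_eq]
  have h := Ring.factorial_nsmul_multichoose_eq_ascPochhammer (1 - c) n
  rw [Polynomial.ascPochhammer_smeval_eq_eval, nsmul_eq_mul] at h
  have hf : (n.factorial : ℝ) ≠ 0 := by positivity
  rw [← mul_right_inj' hf, h]
  clear h hf
  induction n with
  | zero => simp [binCoeff]
  | succ n ih =>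
    rw [ascPochhammer_succ_eval, ih, binCoeff, binCoeff, prod_range_succ, Nat.factorial_succ]
    push_cast
    field_simp
    ring

lemma hasSum_binCoeff (c : ℝ) (hx : x ∈ Set.Ico (0 : ℝ) 1) :
    HasSum (fun n => binCoeff c n * x ^ n) ((1 - x) ^ (c - 1)) := by
  have h := (Real.one_div_one_sub_rpow_hasFPowerSeriesOnBall_zero (1 - c)).hasSum (y := x) (by
    rw [← ENNReal.ofReal_one, Metric.eball_ofReal]
    simpa [abs_of_nonneg hx.1] using hx.2)
  have e : 1 / (1 - x) ^ (1 - c) = (1 - x) ^ (c - 1) := by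
    rw [one_div, ← Real.rpow_neg (by linarith [hx.2]), neg_sub]
  simp only [zero_add, e, FormalMultilinearSeries.ofScalars_apply_eq, binCoeff_eq_choose,
    smul_eq_mul] at h
  exact h

lemma abs_tsum_mul_pow_le {a : ℕ → ℝ} {R : ℝ} (hx : x ∈ Set.Ico (0 : ℝ) 1)
    (ha : ∀ n, |a n| ≤ R * binCoeff c n) :
    |∑' n, a n * x ^ n| ≤ R * (1 - x) ^ (c - 1) := by
  rw [← Real.norm_eq_abs]
  refine tsum_of_norm_bounded ((hasSum_binCoeff c hx).mul_left R) fun n => ?_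
  rw [norm_mul, norm_pow, Real.norm_eq_abs, Real.norm_eq_abs, abs_of_nonneg hx.1, ← mul_assoc]
  exact mul_le_mul_of_nonneg_right (ha n) (pow_nonneg hx.1 n)

lemma tendsto_one_sub_rpow (hc : 0 < c) :
    Tendsto (fun x : ℝ => (1 - x) ^ c) (𝓝[<] 1) (𝓝 0) := by
  have : ContinuousAt (fun x : ℝ => (1 - x) ^ c) 1 :=
    ContinuousAt.rpow_const (by fun_prop) (Or.inr hc.le)
  have h := this.tendsto.mono_left (nhdsWithin_le_nhds (s := Set.Iio 1))
  simpa [Real.zero_rpow hc.ne'] using h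

/-- An Abelian theorem: the power series with coefficients asymptotic to `L` times those of
`(1-x)^(c-1)` is asymptotic to `L (1-x)^(c-1)` at `1`. -/
theorem tendsto_rpow_mul_tsum {r : ℕ → ℝ} {L : ℝ} (hc : c < 1) (hr : Tendsto r atTop (𝓝 L)) :
    Tendsto (fun x : ℝ => (1 - x) ^ (1 - c) * ∑' n, r n * binCoeff c n * x ^ n) (𝓝[<] 1)
      (𝓝 L) := by
  rw [Metric.tendsto_nhds]
  intro ε hε
  obtain ⟨N, hN⟩ := Metric.tendsto_atTop.1 hr (ε / 2) (by positivity)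
  -- The first N error terms contribute at most the constant C, which is killed by (1-x)^(1-c); the
  -- others are at most ε/2 times the binomial series.
  set e : ℕ → ℝ := fun n => (r n - L) * binCoeff c n with he
  set C : ℝ := ∑ n ∈ range N, |e n| with hC
  have hlim := (tendsto_one_sub_rpow (c := 1 - c) (by linarith)).const_mul C
  rw [mul_zero] at hlim
  filter_upwards [hlim.eventually_lt_const (by positivity : 0 < ε / 2),
    Ico_mem_nhdsLT (zero_lt_one' ℝ)] with x hx1 hx
  have hx0 : 0 < 1 - x := by linarith [hx.2]
  have hb := hasSum_binCoeff c hx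
  have hfin : HasSum (fun n => if n ∈ range N then |e n| else 0) C := by
    have : HasSum (fun n => if n ∈ range N then |e n| else 0)
        (∑ n ∈ range N, if n ∈ range N then |e n| else 0) :=
      hasSum_sum_of_ne_finset_zero fun n hn => if_neg hn
    rwa [sum_congr rfl fun n hn => if_pos hn] at this
  have hbound := hfin.add (hb.mul_left (ε / 2))
  have hle (n : ℕ) : ‖e n * x ^ n‖ ≤
      (if n ∈ range N then |e n| else 0) + ε / 2 * (binCoeff c n * x ^ n) := by
    have hbp := (binCoeff_pos hc n).le
    have hxp : 0 ≤ x ^ n := pow_nonneg hx.1 n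
    rw [norm_mul, norm_pow, Real.norm_eq_abs, Real.norm_eq_abs, abs_of_nonneg hx.1]
    split_ifs with hn
    · have h1 : |e n| * x ^ n ≤ |e n| :=
        mul_le_of_le_one_right (abs_nonneg _) (pow_le_one₀ hx.1 hx.2.le)
      have : 0 ≤ ε / 2 * (binCoeff c n * x ^ n) := by positivity
      linarith
    · have h1 := (hN n (by simpa using hn)).le
      rw [Real.dist_eq] at h1
      rw [he, zero_add, abs_mul, abs_of_nonneg hbp, ← mul_assoc]
      gcongr
  have hes : Summable fun n => e n * x ^ n := Summable.of_norm_bounded hbound.summable hle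
  have hsum : ∑' n, r n * binCoeff c n * x ^ n =
      (∑' n, e n * x ^ n) + L * (1 - x) ^ (c - 1) := by
    rw [← hb.tsum_eq, ← tsum_mul_left, ← hes.tsum_add (hb.summable.mul_left L)]
    exact tsum_congr fun n => by rw [he]; ring
  have hpow : (1 - x) ^ (1 - c) * (1 - x) ^ (c - 1) = 1 := by
    rw [← Real.rpow_add hx0]
    simp
  have hE := tsum_of_norm_bounded hbound hle
  rw [Real.norm_eq_abs] at hE
  have hp : 0 < (1 - x) ^ (1 - c) := by positivity
  rw [Real.dist_eq, hsum, show (1 - x) ^ (1 - c) * ((∑' n, e n * x ^ n) + L * (1 - x) ^ (c - 1)) - L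
    = (1 - x) ^ (1 - c) * ∑' n, e n * x ^ n by linear_combination L * hpow, abs_mul, abs_of_pos hp]
  calc _ ≤ (1 - x) ^ (1 - c) * (C + ε / 2 * (1 - x) ^ (c - 1)) := by gcongr
    _ = C * (1 - x) ^ (1 - c) + ε / 2 := by linear_combination ε / 2 * hpow
    _ < ε := by linarith

/-- The ratio to `binCoeff` is a quotient of truncated Euler products for the sine, so its limit is
explicit. -/
lemma kCoeff_eq_mul_binCoeff (hc : c ∈ Set.Ioo (0 : ℝ) 1) (δ : ℝ) (n : ℕ) : kCoeff c δ n =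
    (∏ j ∈ range n, ((1 : ℝ) - δ ^ 2 / ((j : ℝ) + 1) ^ 2)) /
      (∏ j ∈ range n, ((1 : ℝ) - c ^ 2 / ((j : ℝ) + 1) ^ 2)) * binCoeff c n := by
  rw [kCoeff, binCoeff, ← prod_div_distrib, ← prod_mul_distrib]
  refine prod_congr rfl fun j _ => ?_
  have hj : (0 : ℝ) ≤ j := Nat.cast_nonneg j
  have h1 : (j : ℝ) + 1 - c ≠ 0 := by linarith [hc.2]
  have h2 : c + 1 + j ≠ 0 := by linarith [hc.1]
  have h3 : (1 : ℝ) - c ^ 2 / ((j : ℝ) + 1) ^ 2 =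
      ((j : ℝ) + 1 - c) * (c + 1 + j) / ((j : ℝ) + 1) ^ 2 := by
    field_simp
    ring
  rw [h3]
  field_simp

/-- The ratio of the coefficients of `(δ/c) ₂F₁(1+δ,1-δ;1+c;x)` and `(1-x)^(c-1)`. -/
lemma sCoeff_eq_mul_binCoeff (hc : c ∈ Set.Ioo (0 : ℝ) 1) (δ : ℝ) (n : ℕ) : sCoeff c δ n =
    (Real.pi * δ * ∏ j ∈ range n, ((1 : ℝ) - δ ^ 2 / ((j : ℝ) + 1) ^ 2)) /
      (Real.pi * c * ∏ j ∈ range n, ((1 : ℝ) - c ^ 2 / ((j : ℝ) + 1) ^ 2)) * binCoeff c n := by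
  rw [sCoeff, kCoeff_eq_mul_binCoeff hc, mul_assoc Real.pi, mul_assoc Real.pi,
    mul_div_mul_left _ _ Real.pi_ne_zero, mul_div_mul_comm, mul_assoc]

lemma sin_pi_mul_pos (hc : c ∈ Set.Ioo (0 : ℝ) 1) : 0 < Real.sin (Real.pi * c) :=
  Real.sin_pos_of_pos_of_lt_pi (mul_pos Real.pi_pos hc.1)
    (mul_lt_of_lt_one_right Real.pi_pos hc.2)

lemma tendsto_rpow_mul_hypS (hc : c ∈ Set.Ioo (0 : ℝ) 1) (δ : ℝ) :
    Tendsto (fun x : ℝ => (1 - x) ^ (1 - c) * hypS c δ x) (𝓝[<] 1)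
      (𝓝 (Real.sin (Real.pi * δ) / Real.sin (Real.pi * c))) := by
  have h := tendsto_rpow_mul_tsum hc.2 ((Real.tendsto_euler_sin_prod δ).div
    (Real.tendsto_euler_sin_prod c) (sin_pi_mul_pos hc).ne')
  refine h.congr fun x => ?_
  simp only [hypS, sCoeff_eq_mul_binCoeff hc, Pi.div_apply]

/-- A bound for `hypS`, uniform in `δ`. -/
lemma exists_abs_hypS_le (hc : c ∈ Set.Ioo (0 : ℝ) 1) : ∃ R, 0 ≤ R ∧ ∀ δ x : ℝ, |δ| < 1 →
    x ∈ Set.Ico (0 : ℝ) 1 → |hypS c δ x| ≤ R * (1 - x) ^ (c - 1) := by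
  -- This sequence is the ratio of the majorant `1 / c * kCoeff c 0 n` to `binCoeff c n`; being
  -- convergent, it is bounded.
  have h := (tendsto_const_nhds (x := Real.pi)).div (Real.tendsto_euler_sin_prod c)
    (sin_pi_mul_pos hc).ne'
  obtain ⟨R, hR⟩ := h.bddAbove_range
  have hR' (n : ℕ) : 1 / c * kCoeff c 0 n ≤ R * binCoeff c n := by
    have h1 := mul_le_mul_of_nonneg_right (hR (Set.mem_range_self n)) (binCoeff_pos hc.2 n).le
    refine le_of_eq_of_le ?_ h1
    have h2 : ∏ j ∈ range n, ((1 : ℝ) - 0 ^ 2 / ((j : ℝ) + 1) ^ 2) = 1 := by simp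
    rw [kCoeff_eq_mul_binCoeff hc, h2, Pi.div_apply, ← mul_assoc, div_mul_div_comm, mul_assoc Real.pi,
      ← div_div Real.pi, div_self Real.pi_ne_zero, one_mul]
  refine ⟨R, ?_, fun δ x hδ hx => abs_tsum_mul_pow_le hx fun n =>
    (abs_sCoeff_le hc.1 hδ n).trans (hR' n)⟩
  have h0 := hR' 0
  simp only [kCoeff_zero, binCoeff, range_zero, prod_empty, mul_one] at h0
  exact (one_div_pos.2 hc.1).le.trans h0

end Abel


/-! ### The pairing integral through the Wronskian -/

/-- The weight of `hypF` in the Sturm-Liouville system. -/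
def fWeight (c v : ℝ) : ℝ := v ^ (c - 1) * (1 - v) ^ (-c)

/-- The weight of `hypS` in the Sturm-Liouville system. -/
def sWeight (c v : ℝ) : ℝ := v ^ c * (1 - v) ^ (1 - c)

/-- The density of the pairing of the solutions with parameters `δ` and `ε`. -/
def pairing (c δ ε v : ℝ) : ℝ :=
  fWeight c v * (hypF c δ v * hypF c ε v) + sWeight c v * (hypS c δ v * hypS c ε v)

section Pairing

variable {c δ ε v : ℝ}

lemma abs_lt_one_of_mem (hv : v ∈ Set.Ioo (0 : ℝ) 1) : |v| < 1 := by
  rw [abs_of_pos hv.1]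
  exact hv.2

lemma fWeight_mul (c : ℝ) (hv : v ∈ Set.Ioo (0 : ℝ) 1) :
    fWeight c v * (v * (1 - v)) = sWeight c v := by
  have h1 : 0 < 1 - v := by linarith [hv.2]
  rw [fWeight, sWeight, sub_eq_neg_add 1 c, Real.rpow_add h1, Real.rpow_one,
    Real.rpow_sub_one hv.1.ne']
  have := hv.1.ne'
  field_simp

lemma hasDerivAt_sWeight (c : ℝ) (hv : v ∈ Set.Ioo (0 : ℝ) 1) :
    HasDerivAt (sWeight c) (fWeight c v * (c - v)) v := by
  have h1 : 0 < 1 - v := by linarith [hv.2]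
  have hd := (Real.hasDerivAt_rpow_const (p := c) (Or.inl hv.1.ne')).mul
    (((hasDerivAt_id v).const_sub 1).rpow_const (p := 1 - c) (Or.inl h1.ne'))
  refine hd.congr_deriv ?_
  have e1 : (1 - v) ^ (1 - c) = (1 - v) * (1 - v) ^ (-c) := by
    rw [sub_eq_neg_add 1 c, Real.rpow_add h1, Real.rpow_one, mul_comm]
  have e2 : v ^ c = v * v ^ (c - 1) := by
    rw [Real.rpow_sub_one hv.1.ne']
    have := hv.1.ne'
    field_simp
  simp only [id, fWeight, show 1 - c - 1 = -c by ring, e1]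
  rw [e2]
  ring

lemma hasDerivAt_sWeight_mul_hypS (hc : 0 < c) (hδ : |δ| < 1) (hv : v ∈ Set.Ioo (0 : ℝ) 1) :
    HasDerivAt (fun v => sWeight c v * hypS c δ v) (δ * (fWeight c v * hypF c δ v)) v := by
  obtain ⟨D, hD, hD'⟩ := hasDerivAt_hypS hc hδ (abs_lt_one_of_mem hv)
  refine ((hasDerivAt_sWeight c hv).mul hD).congr_deriv ?_
  rw [← fWeight_mul c hv]
  linear_combination fWeight c v * hD'

/-- The Lagrange identity of the system: the product rule leaves the same two terms wFF and pSS with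
coefficients δ and -ε. -/
lemma hasDerivAt_wronskian (hc : 0 < c) (hδ : |δ| < 1) (hε : |ε| < 1)
    (hv : v ∈ Set.Ioo (0 : ℝ) 1) :
    HasDerivAt (fun v => hypF c ε v * (sWeight c v * hypS c δ v) -
      hypF c δ v * (sWeight c v * hypS c ε v)) ((δ - ε) * pairing c δ ε v) v := by
  have hv' := abs_lt_one_of_mem hv
  refine (((hasDerivAt_hypF hc hε hv').mul (hasDerivAt_sWeight_mul_hypS hc hδ hv)).sub
    ((hasDerivAt_hypF hc hδ hv').mul (hasDerivAt_sWeight_mul_hypS hc hε hv))).congr_deriv ?_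
  rw [pairing]
  ring

lemma intervalIntegrable_rpow_mul_one_sub_rpow {a b : ℝ} (ha : 0 < a) (hb : 0 < b) :
    IntervalIntegrable (fun v : ℝ => v ^ (a - 1) * (1 - v) ^ (b - 1)) volume 0 1 := by
  have h := (Complex.betaIntegral_convergent (u := a) (v := b) (by simpa) (by simpa)).norm
  rw [intervalIntegrable_iff_integrableOn_Ioo_of_le zero_le_one] at h ⊢
  refine h.congr_fun (fun v hv => ?_) measurableSet_Ioo
  have h1 : 0 < 1 - v := by linarith [hv.2]
  have e : (1 : ℂ) - (v : ℂ) = ((1 - v : ℝ) : ℂ) := by push_cast; rfl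
  simp only [norm_mul]
  rw [e, Complex.norm_cpow_eq_rpow_re_of_pos hv.1, Complex.norm_cpow_eq_rpow_re_of_pos h1]
  simp

lemma fWeight_nonneg (c : ℝ) (hv : v ∈ Set.Ioo (0 : ℝ) 1) : 0 ≤ fWeight c v :=
  mul_nonneg (Real.rpow_nonneg hv.1.le _) (Real.rpow_nonneg (by linarith [hv.2]) _)

lemma sWeight_nonneg (c : ℝ) (hv : v ∈ Set.Ioo (0 : ℝ) 1) : 0 ≤ sWeight c v :=
  mul_nonneg (Real.rpow_nonneg hv.1.le _) (Real.rpow_nonneg (by linarith [hv.2]) _)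

lemma sWeight_mul_rpow (c : ℝ) (hv : v ∈ Set.Ioo (0 : ℝ) 1) :
    sWeight c v * (1 - v) ^ (c - 1) = v ^ c := by
  have h1 : 0 < 1 - v := by linarith [hv.2]
  rw [sWeight, mul_assoc, ← Real.rpow_add h1]
  simp

/-- An integrable majorant of the pairing, uniform in both parameters. -/
lemma exists_abs_pairing_le (hc : c ∈ Set.Ioo (0 : ℝ) 1) :
    ∃ B : ℝ → ℝ, IntervalIntegrable B volume 0 1 ∧ ∀ δ ε v : ℝ, |δ| < 1 → |ε| < 1 →
      v ∈ Set.Ioo (0 : ℝ) 1 → |pairing c δ ε v| ≤ B v := by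
  obtain ⟨R, hR0, hR⟩ := exists_abs_hypS_le hc
  set M := ∑' n, fBound c n with hM
  have hM0 : 0 ≤ M := tsum_nonneg (fBound_nonneg hc.1)
  -- F is bounded and S is O((1-v)^(c-1)), so the two parts are dominated by w and by p(1-v)^(2c-2)
  -- = v^c (1-v)^(c-1), both beta integrands.
  have i1 := intervalIntegrable_rpow_mul_one_sub_rpow hc.1 (b := 1 - c) (by linarith [hc.2])
  have i2 := intervalIntegrable_rpow_mul_one_sub_rpow (a := c + 1) (by linarith [hc.1]) hc.1
  refine ⟨_, (i1.const_mul (M * M)).add (i2.const_mul (R * R)), fun δ ε v hδ hε hv => ?_⟩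
  have hv1 : v ∈ Set.Icc (0 : ℝ) 1 := ⟨hv.1.le, hv.2.le⟩
  have hv2 : v ∈ Set.Ico (0 : ℝ) 1 := ⟨hv.1.le, hv.2⟩
  have h1 : 0 < 1 - v := by linarith [hv.2]
  have hw := fWeight_nonneg c hv
  have hp := sWeight_nonneg c hv
  have hX : 0 ≤ (1 - v) ^ (c - 1) := by positivity
  have a1 : |fWeight c v * (hypF c δ v * hypF c ε v)| ≤ M * M * fWeight c v := by
    rw [abs_mul, abs_mul, abs_of_nonneg hw, mul_comm]
    gcongr
    · exact abs_hypF_le hc.1 hδ hv1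
    · exact abs_hypF_le hc.1 hε hv1
  have a2 : |sWeight c v * (hypS c δ v * hypS c ε v)| ≤ R * R * (v ^ c * (1 - v) ^ (c - 1)) := by
    rw [abs_mul, abs_mul, abs_of_nonneg hp]
    calc _ ≤ sWeight c v * ((R * (1 - v) ^ (c - 1)) * (R * (1 - v) ^ (c - 1))) := by
          gcongr
          · exact hR δ v hδ hv2
          · exact hR ε v hε hv2
      _ = _ := by rw [← sWeight_mul_rpow c hv]; ring
  refine (abs_add_le _ _).trans ((add_le_add a1 a2).trans (le_of_eq ?_))
  simp only [fWeight, add_sub_cancel_right, sub_sub_cancel_left]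

lemma continuousOn_pairing (hc : 0 < c) (hδ : |δ| < 1) (hε : |ε| < 1) :
    ContinuousOn (pairing c δ ε) (Set.Ioo 0 1) := by
  intro v hv
  have hv' := abs_lt_one_of_mem hv
  have h1 : 1 - v ≠ 0 := by linarith [hv.2]
  have cw : ContinuousAt (fWeight c) v := by
    refine ContinuousAt.mul (Real.continuousAt_rpow_const _ _ (Or.inl hv.1.ne')) ?_
    exact ContinuousAt.rpow_const (by fun_prop) (Or.inl h1)
  obtain ⟨_, d1, -⟩ := hasDerivAt_hypS hc hδ hv'
  obtain ⟨_, d2, -⟩ := hasDerivAt_hypS hc hε hv'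
  refine ((cw.mul ((hasDerivAt_hypF hc hδ hv').continuousAt.mul
    (hasDerivAt_hypF hc hε hv').continuousAt)).add
    ((hasDerivAt_sWeight c hv).continuousAt.mul
      (d1.continuousAt.mul d2.continuousAt))).continuousWithinAt

lemma aestronglyMeasurable_pairing (hc : 0 < c) (hδ : |δ| < 1) (hε : |ε| < 1) :
    AEStronglyMeasurable (pairing c δ ε) (volume.restrict (Set.uIoc 0 1)) := by
  rw [Set.uIoc_of_le zero_le_one, ← restrict_Ioo_eq_restrict_Ioc]
  exact (continuousOn_pairing hc hδ hε).aestronglyMeasurable measurableSet_Ioo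

lemma ae_mem_Ioo_of_mem_uIoc : ∀ᵐ v : ℝ, v ∈ Set.uIoc (0 : ℝ) 1 → v ∈ Set.Ioo (0 : ℝ) 1 := by
  filter_upwards [compl_mem_ae_iff.2 (measure_singleton (μ := volume) (1 : ℝ))] with v hv hv'
  rw [Set.uIoc_of_le zero_le_one] at hv'
  exact ⟨hv'.1, lt_of_le_of_ne hv'.2 hv⟩

lemma intervalIntegrable_pairing (hc : c ∈ Set.Ioo (0 : ℝ) 1) (hδ : |δ| < 1) (hε : |ε| < 1) :
    IntervalIntegrable (pairing c δ ε) volume 0 1 := by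
  obtain ⟨B, hB, hle⟩ := exists_abs_pairing_le hc
  refine hB.mono_fun (aestronglyMeasurable_pairing hc.1 hδ hε) ?_
  rw [EventuallyLE, ae_restrict_iff' measurableSet_uIoc]
  filter_upwards [ae_mem_Ioo_of_mem_uIoc] with v hv hv'
  exact (hle δ ε v hδ hε (hv hv')).trans (le_abs_self _)

lemma tendsto_sWeight_mul_hypS_one (hc : c ∈ Set.Ioo (0 : ℝ) 1) (δ : ℝ) :
    Tendsto (fun v => sWeight c v * hypS c δ v) (𝓝[<] 1)
      (𝓝 (Real.sin (Real.pi * δ) / Real.sin (Real.pi * c))) := by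
  have h : Tendsto (fun v : ℝ => v ^ c) (𝓝[<] 1) (𝓝 1) := by
    have h1 := (Real.continuousAt_rpow_const 1 c (Or.inl one_ne_zero)).tendsto
    rw [Real.one_rpow] at h1
    exact h1.mono_left nhdsWithin_le_nhds
  have := h.mul (tendsto_rpow_mul_hypS hc δ)
  rw [one_mul] at this
  exact this.congr fun v => by rw [sWeight, mul_assoc]

lemma tendsto_sWeight_mul_hypS_zero (hc : c ∈ Set.Ioo (0 : ℝ) 1) (hδ : |δ| < 1) :
    Tendsto (fun v => sWeight c v * hypS c δ v) (𝓝[>] 0) (𝓝 0) := by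
  obtain ⟨R, hR0, hR⟩ := exists_abs_hypS_le hc
  have h : Tendsto (fun v : ℝ => R * v ^ c) (𝓝[>] 0) (𝓝 0) := by
    have h1 := (Real.continuousAt_rpow_const 0 c (Or.inr hc.1.le)).tendsto
    rw [Real.zero_rpow hc.1.ne'] at h1
    simpa using (h1.mono_left nhdsWithin_le_nhds).const_mul R
  refine squeeze_zero_norm' ?_ h
  filter_upwards [Ioo_mem_nhdsGT (zero_lt_one' ℝ)] with v hv
  have hp := sWeight_nonneg c hv
  rw [norm_mul, Real.norm_eq_abs, Real.norm_eq_abs, abs_of_nonneg hp, ← sWeight_mul_rpow c hv]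
  have := mul_le_mul_of_nonneg_left (hR δ v hδ ⟨hv.1.le, hv.2⟩) hp
  linarith

lemma tendsto_hypF_left (hc : 0 < c) (hδ : |δ| < 1) :
    Tendsto (hypF c δ) (𝓝[<] 1) (𝓝 (hypF c δ 1)) := by
  have h := continuousOn_hypF hc hδ 1 ⟨zero_le_one, le_rfl⟩
  refine h.tendsto.mono_left (nhdsWithin_le_of_mem ?_)
  exact mem_of_superset (Ico_mem_nhdsLT (zero_lt_one' ℝ)) Set.Ico_subset_Icc_self

lemma tendsto_hypF_right (hc : 0 < c) (hδ : |δ| < 1) :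
    Tendsto (hypF c δ) (𝓝[>] 0) (𝓝 (hypF c δ 0)) := by
  have h := continuousOn_hypF hc hδ 0 ⟨le_rfl, zero_le_one⟩
  refine h.tendsto.mono_left (nhdsWithin_le_of_mem ?_)
  exact mem_of_superset (Ioc_mem_nhdsGT (zero_lt_one' ℝ)) Set.Ioc_subset_Icc_self

lemma integral_pairing (hc : c ∈ Set.Ioo (0 : ℝ) 1) (hδ : |δ| < 1) (hε : |ε| < 1) :
    (δ - ε) * ∫ v in (0 : ℝ)..1, pairing c δ ε v =
      hypF c ε 1 * (Real.sin (Real.pi * δ) / Real.sin (Real.pi * c)) -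
        hypF c δ 1 * (Real.sin (Real.pi * ε) / Real.sin (Real.pi * c)) := by
  have h := intervalIntegral.integral_eq_sub_of_hasDerivAt_of_tendsto zero_lt_one
    (fun v hv => hasDerivAt_wronskian hc.1 hδ hε hv)
    ((intervalIntegrable_pairing hc hδ hε).const_mul (δ - ε))
    (((tendsto_hypF_right hc.1 hε).mul (tendsto_sWeight_mul_hypS_zero hc hδ)).sub
      ((tendsto_hypF_right hc.1 hδ).mul (tendsto_sWeight_mul_hypS_zero hc hε)))
    (((tendsto_hypF_left hc.1 hε).mul (tendsto_sWeight_mul_hypS_one hc δ)).sub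
      ((tendsto_hypF_left hc.1 hδ).mul (tendsto_sWeight_mul_hypS_one hc ε)))
  rw [intervalIntegral.integral_const_mul] at h
  rw [h]
  ring

lemma tendsto_integral_pairing (hc : c ∈ Set.Ioo (0 : ℝ) 1) (hδ : |δ| < 1) :
    Tendsto (fun ε => ∫ v in (0 : ℝ)..1, pairing c δ ε v) (𝓝 δ)
      (𝓝 (∫ v in (0 : ℝ)..1, pairing c δ δ v)) := by
  obtain ⟨B, hB, hle⟩ := exists_abs_pairing_le hc
  have hnear : ∀ᶠ ε in 𝓝 δ, |ε| < 1 := isOpen_abs_lt_one.mem_nhds hδ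
  refine intervalIntegral.tendsto_integral_filter_of_dominated_convergence B ?_ ?_ hB ?_
  · filter_upwards [hnear] with ε hε using aestronglyMeasurable_pairing hc.1 hδ hε
  · filter_upwards [hnear] with ε hε
    filter_upwards [ae_mem_Ioo_of_mem_uIoc] with v hv hv'
    exact hle δ ε v hδ hε (hv hv')
  · filter_upwards [ae_mem_Ioo_of_mem_uIoc] with v hv hv'
    have hv := hv hv'
    have h1 := (continuousAt_hypF hc.1 hδ ⟨hv.1.le, hv.2.le⟩).tendsto
    have h2 := (continuousAt_hypS hc.1 hδ (abs_lt_one_of_mem hv)).tendsto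
    exact ((h1.const_mul _).const_mul _).add ((h2.const_mul _).const_mul _)

lemma hasDerivAt_sin_pi_mul (δ : ℝ) : HasDerivAt (fun ε => Real.sin (Real.pi * ε))
    (Real.pi * Real.cos (Real.pi * δ)) δ := by
  refine ((Real.hasDerivAt_sin _).comp δ ((hasDerivAt_id δ).const_mul Real.pi)).congr_deriv ?_
  simp [mul_comm]

lemma integral_pairing_self (hc : c ∈ Set.Ioo (0 : ℝ) 1) (hδ : |δ| < 1) {A' : ℝ}
    (hA : HasDerivAt (fun ε => hypF c ε 1) A' δ) :
    ∫ v in (0 : ℝ)..1, pairing c δ δ v =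
      (hypF c δ 1 * (Real.pi * Real.cos (Real.pi * δ)) - A' * Real.sin (Real.pi * δ)) /
        Real.sin (Real.pi * c) := by
  -- As a function of ε, the negated right side of `integral_pairing` vanishes at ε = δ, so the
  -- integral is its difference quotient there.
  have hg := (((hasDerivAt_sin_pi_mul δ).const_mul (hypF c δ 1)).sub
    (hA.mul_const (Real.sin (Real.pi * δ)))).div_const (Real.sin (Real.pi * c))
  rw [hasDerivAt_iff_tendsto_slope] at hg
  refine tendsto_nhds_unique ((tendsto_integral_pairing hc hδ).mono_left nhdsWithin_le_nhds)
    (hg.congr' ?_)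
  filter_upwards [nhdsWithin_le_nhds (isOpen_abs_lt_one.mem_nhds hδ), self_mem_nhdsWithin]
    with ε hε hne
  have hne' : ε - δ ≠ 0 := sub_ne_zero.2 hne
  have h := integral_pairing hc hδ hε
  rw [slope_def_field, div_eq_iff hne']
  simp only [Pi.sub_apply]
  linear_combination h

end Pairing

/-! ### Reflection formula and the weighted sum -/

section Connection

variable {c δ κ v : ℝ}

lemma differentiable_inv_Gamma : Differentiable ℝ fun s : ℝ => (Real.Gamma s)⁻¹ := by
  intro s
  have h := ((Complex.differentiable_one_div_Gamma s).hasDerivAt.real_of_complex).differentiableAt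
  refine h.congr_of_eventuallyEq (Eventually.of_forall fun x => ?_)
  simp only [Complex.Gamma_ofReal, ← Complex.ofReal_inv, Complex.ofReal_re]

/-- Gauss's formula is written with 1/Γ, which is differentiable everywhere, so c ± δ = 0 needs no
separate case. -/
lemma differentiableAt_hypF_one (hc : 0 < c) (hδ : |δ| < 1) :
    DifferentiableAt ℝ (fun ε => hypF c ε 1) δ := by
  have h : DifferentiableAt ℝ (fun ε => Real.Gamma c ^ 2 *
      ((Real.Gamma (c + ε))⁻¹ * (Real.Gamma (c - ε))⁻¹)) δ := by
    refine DifferentiableAt.const_mul (DifferentiableAt.mul ?_ ?_) _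
    · exact (differentiable_inv_Gamma (c + δ)).comp δ (by fun_prop)
    · exact (differentiable_inv_Gamma (c - δ)).comp δ (by fun_prop)
  refine h.congr_of_eventuallyEq ?_
  filter_upwards [isOpen_abs_lt_one.mem_nhds hδ] with ε hε
  rw [hypF_one_eq_Gamma hc hε, div_eq_mul_inv, mul_inv]

lemma hypF_one_mul_hypF_one (hc : c ∈ Set.Ioo (0 : ℝ) 1) (hδ : |δ| < 1) :
    hypF c δ 1 * hypF (1 - c) δ 1 =
      1 - Real.sin (Real.pi * δ) ^ 2 / Real.sin (Real.pi * c) ^ 2 := by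
  have hs := (sin_pi_mul_pos hc).ne'
  have hπ := Real.pi_ne_zero
  rw [hypF_one_eq_Gamma hc.1 hδ, hypF_one_eq_Gamma (by linarith [hc.2]) hδ]
  have h0 := Real.Gamma_mul_Gamma_one_sub c
  have h1 := Real.Gamma_mul_Gamma_one_sub (c + δ)
  have h2 := Real.Gamma_mul_Gamma_one_sub (c - δ)
  rw [show 1 - (c + δ) = 1 - c - δ by ring] at h1
  rw [show 1 - (c - δ) = 1 - c + δ by ring] at h2
  have e : Real.sin (Real.pi * (c + δ)) * Real.sin (Real.pi * (c - δ)) =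
      Real.sin (Real.pi * c) ^ 2 - Real.sin (Real.pi * δ) ^ 2 := by
    rw [mul_add, mul_sub, Real.sin_add, Real.sin_sub]
    linear_combination -Real.sin (Real.pi * c) ^ 2 * Real.sin_sq_add_cos_sq (Real.pi * δ) * (-1) +
      Real.sin (Real.pi * δ) ^ 2 * Real.sin_sq_add_cos_sq (Real.pi * c) * (-1)
  calc _ = (Real.Gamma c * Real.Gamma (1 - c)) ^ 2 /
        ((Real.Gamma (c + δ) * Real.Gamma (1 - c - δ)) *
          (Real.Gamma (c - δ) * Real.Gamma (1 - c + δ))) := by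
        rw [div_mul_div_comm]
        congr 1 <;> ring
    _ = (Real.sin (Real.pi * (c + δ)) * Real.sin (Real.pi * (c - δ))) /
        Real.sin (Real.pi * c) ^ 2 := by
        rw [h0, h1, h2, div_mul_div_comm, div_pow, div_div_div_eq, ← sq,
          mul_comm (Real.sin (Real.pi * c) ^ 2), mul_div_mul_left _ _ (pow_ne_zero 2 hπ)]
    _ = _ := by
        rw [e]
        field_simp

/-- The weighted sum of the norms for `c` and `1 - c`. -/
theorem integral_pairing_add (hc : c ∈ Set.Ioo (0 : ℝ) 1) (hδ : |δ| < 1) :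
    hypF (1 - c) δ 1 * (∫ v in (0 : ℝ)..1, pairing c δ δ v) +
      hypF c δ 1 * (∫ v in (0 : ℝ)..1, pairing (1 - c) δ δ v) =
        2 * Real.pi * Real.cos (Real.pi * δ) / Real.sin (Real.pi * c) := by
  have hc' : 1 - c ∈ Set.Ioo (0 : ℝ) 1 := ⟨by linarith [hc.2], by linarith [hc.1]⟩
  have hs := (sin_pi_mul_pos hc).ne'
  have hA := (differentiableAt_hypF_one hc.1 hδ).hasDerivAt
  have hB := (differentiableAt_hypF_one hc'.1 hδ).hasDerivAt
  have hP : HasDerivAt (fun ε => hypF c ε 1 * hypF (1 - c) ε 1)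
      (-(2 * Real.sin (Real.pi * δ) * (Real.pi * Real.cos (Real.pi * δ)) /
        Real.sin (Real.pi * c) ^ 2)) δ := by
    have h := (((hasDerivAt_sin_pi_mul δ).pow 2).div_const
      (Real.sin (Real.pi * c) ^ 2)).const_sub 1
    refine (h.congr_deriv (by simp)).congr_of_eventuallyEq ?_
    filter_upwards [isOpen_abs_lt_one.mem_nhds hδ] with ε hε using hypF_one_mul_hypF_one hc hε
  -- Two computations of (AB)': this eliminates the unknown derivatives of A and B, which enter the
  -- weighted sum only through A'B + AB'.
  have hsum := hP.unique (hA.mul hB)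
  have hprod := hypF_one_mul_hypF_one hc hδ
  have hsin : Real.sin (Real.pi * (1 - c)) = Real.sin (Real.pi * c) := by
    rw [mul_sub, mul_one, Real.sin_pi_sub]
  rw [integral_pairing_self hc hδ hA, integral_pairing_self hc' hδ hB, hsin]
  set s := Real.sin (Real.pi * δ)
  set S := Real.sin (Real.pi * c)
  set k := Real.cos (Real.pi * δ)
  set A := hypF c δ 1
  set B := hypF (1 - c) δ 1
  calc _ = (2 * (A * B) * (Real.pi * k) - (deriv (fun ε => hypF c ε 1) δ * B +
        A * deriv (fun ε => hypF (1 - c) ε 1) δ) * s) / S := by ring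
    _ = _ := by
      rw [hprod, ← hsum]
      field_simp
      ring

lemma H_eq_hypF_one (hκ : -(1 / 2) < κ) (hδ : |δ| < 1) : H κ δ = hypF (1 / 2 + κ) δ 1 := by
  rw [H, hypF_one_eq_Gamma (by linarith) hδ]

lemma f_sq_add_f_sq_mul (κ δ : ℝ) (hv : v ∈ Set.Ioo (0 : ℝ) 1) :
    (f₁ κ δ v ^ 2 + f₂ κ δ v ^ 2) * (v * (1 - v)) ^ (-(1 / 2) : ℝ) =
      pairing (1 / 2 + κ) δ δ v := by
  have h0 := hv.1
  have h1 : 0 < 1 - v := by linarith [hv.2]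
  have e1 : f₁ κ δ v = v ^ (κ / 2) * (1 - v) ^ (-κ / 2) * hypF (1 / 2 + κ) δ v := by
    rw [f₁, hypF_eq]
  have e2 : f₂ κ δ v = v ^ ((κ + 1) / 2) * (1 - v) ^ ((1 - κ) / 2) * hypS (1 / 2 + κ) δ v := by
    rw [f₂, ← hypS_eq, show 3 / 2 + κ = 1 + (1 / 2 + κ) by ring]
    ring
  have sq (x a : ℝ) (hx : 0 < x) : (x ^ a) ^ 2 = x ^ (2 * a) := by
    rw [← Real.rpow_natCast, ← Real.rpow_mul hx.le]
    congr 1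
    push_cast
    ring
  rw [e1, e2, pairing, fWeight, sWeight, Real.mul_rpow h0.le h1.le]
  simp only [mul_pow, sq v _ h0, sq (1 - v) _ h1]
  rw [show 1 / 2 + κ - 1 = 2 * (κ / 2) + -(1 / 2) by ring,
    show -(1 / 2 + κ) = 2 * (-κ / 2) + -(1 / 2) by ring,
    show 1 - (1 / 2 + κ) = 2 * ((1 - κ) / 2) + -(1 / 2) by ring, Real.rpow_add h0,
    Real.rpow_add h1, Real.rpow_add h1]
  have e3 : v ^ (1 / 2 + κ) = v ^ (2 * ((κ + 1) / 2)) * v ^ (-(1 / 2) : ℝ) := by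
    rw [← Real.rpow_add h0]
    congr 1
    ring
  rw [e3]
  ring

lemma G₁_mul_eq (hκ₁ : -(1 / 2) < κ) (hκ₂ : κ < 1 / 2) (hδ : |δ| < 1)
    (hv : v ∈ Set.Ioo (0 : ℝ) 1) : G₁ κ δ v * (v * (1 - v)) ^ (-(1 / 2) : ℝ) =
      hypF (1 - (1 / 2 + κ)) δ 1 * pairing (1 / 2 + κ) δ δ v +
        hypF (1 / 2 + κ) δ 1 * pairing (1 - (1 / 2 + κ)) δ δ v := by
  have e : 1 - (1 / 2 + κ) = 1 / 2 + -κ := by ring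
  rw [e, ← f_sq_add_f_sq_mul κ δ hv, ← f_sq_add_f_sq_mul (-κ) δ hv, ← H_eq_hypF_one hκ₁ hδ,
    ← H_eq_hypF_one (by linarith) hδ, G₁]
  ring

/-- Integrability of the weighted diagonal entry, and the value of its integral. -/
theorem integral_G₁ (hκ₁ : -(1 / 2) < κ) (hκ₂ : κ < 1 / 2) (hδ : |δ| < 1) :
    IntervalIntegrable (fun v : ℝ => G₁ κ δ v * (v * (1 - v)) ^ (-(1 / 2) : ℝ)) volume 0 1 ∧
      ∫ v in (0 : ℝ)..1, G₁ κ δ v * (v * (1 - v)) ^ (-(1 / 2) : ℝ) =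
        2 * Real.pi * Real.cos (Real.pi * δ) / Real.cos (Real.pi * κ) := by
  have hc : 1 / 2 + κ ∈ Set.Ioo (0 : ℝ) 1 := ⟨by linarith, by linarith⟩
  have hc' : 1 - (1 / 2 + κ) ∈ Set.Ioo (0 : ℝ) 1 := ⟨by linarith, by linarith⟩
  have i1 := (intervalIntegrable_pairing hc hδ hδ).const_mul (hypF (1 - (1 / 2 + κ)) δ 1)
  have i2 := (intervalIntegrable_pairing hc' hδ hδ).const_mul (hypF (1 / 2 + κ) δ 1)
  constructor
  · have h := i1.add i2
    rw [intervalIntegrable_iff_integrableOn_Ioo_of_le zero_le_one] at h ⊢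
    exact h.congr_fun (fun v hv => (G₁_mul_eq hκ₁ hκ₂ hδ hv).symm) measurableSet_Ioo
  · rw [intervalIntegral.integral_congr_ae (ae_mem_Ioo_of_mem_uIoc.mono fun v hv hv' =>
        G₁_mul_eq hκ₁ hκ₂ hδ (hv hv')), intervalIntegral.integral_add i1 i2,
      intervalIntegral.integral_const_mul, intervalIntegral.integral_const_mul,
      integral_pairing_add hc hδ, mul_add, show Real.pi * (1 / 2) = Real.pi / 2 by ring, add_comm,
      Real.sin_add_pi_div_two]

end Connection

end DihedralKernel

end

theorem proposition6p3 (κ δ : ℝ) (hκ₁ : -(1 / 2) < κ) (hκ₂ : κ < 1 / 2)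
    (hδ₁ : 0 ≤ δ) (hδ₂ : δ < 1 / 2) :
    IntervalIntegrable
        (fun v : ℝ => DihedralKernel.G₁ κ δ v * (v * (1 - v)) ^ (-(1 / 2) : ℝ)) volume 0 1 ∧
      IntervalIntegrable
        (fun v : ℝ => DihedralKernel.G₁ 0 δ v * (v * (1 - v)) ^ (-(1 / 2) : ℝ)) volume 0 1 ∧
      ∫ v in (0 : ℝ)..1, DihedralKernel.G₁ κ δ v * (v * (1 - v)) ^ (-(1 / 2) : ℝ) =
        1 / Real.cos (Real.pi * κ) *
          ∫ v in (0 : ℝ)..1, DihedralKernel.G₁ 0 δ v * (v * (1 - v)) ^ (-(1 / 2) : ℝ) := by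
  have hδ : |δ| < 1 := abs_lt.2 ⟨by linarith, by linarith⟩
  obtain ⟨i1, e1⟩ := DihedralKernel.integral_G₁ hκ₁ hκ₂ hδ
  obtain ⟨i2, e2⟩ := DihedralKernel.integral_G₁ (κ := 0) (by norm_num) (by norm_num) hδ
  refine ⟨i1, i2, ?_⟩
  rw [e1, e2, mul_zero, Real.cos_zero]
  ring
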